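/- Let $X$ and $Y$ be Polish spaces, let $\pi$ be a Borel probability measure on $X\times Y$ with first marginal $\mu$, and let $(\pi_x)_{x\in X}$ be a regular disintegration of $\pi$ with respect to $\mu$. Let $c\colon X\times Y\to\mathbb R$ be Borel measurable with $c\in L^1(\pi)$. For $x\in X$ and a Borel probability measure $p$ on $Y$ put $C(x,p):=\int_Y c(x,y)\,p(dy):=\int_Y c(x,y)^+\,p(dy)-\int_Y c(x,y)^-\,p(dy)\in[-\infty,\infty]$. Here, and in the sums of values of $C$ below, any expression of the form $\infty-\infty$ is given one fixed but arbitrary value $d\in[-\infty,\infty]$. * $\pi$ is called *$c$-cyclically monotone* if there is a Borel set $\hat\Gamma\subset X\times Y$ with $\pi(\hat\Gamma)=1$ such that $\sum_{i=1}^N c(x_i,y_i)\le\sum_{i=1}^N c(x_i,y_{i+1})$ (where $y_{N+1}:=y_1$) for all $N\ge 1$ and $(x_1,y_1),\dots,(x_N,y_N)\in\hat\Gamma$. * $\pi$ is called *$C$-monotone* if there is a Borel set $\Gamma\subset X$ with $\mu(\Gamma)=1$ such that, for any finite number of points $x_1,\dots,x_N\in\Gamma$ and any Borel probability measures $q_1,\dots,q_N$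 on $Y$ with $\sum_{i=1}^N\pi_{x_i}=\sum_{i=1}^N q_i$, one has $\sum_{i=1}^N C(x_i,\pi_{x_i})\le\sum_{i=1}^N C(x_i,q_i)$. Then the following hold for every choice of $d$. 1. If $\pi$ is $c$-cyclically monotone, then $\pi$ is $C$-monotone. 2. If $c(x,\cdot)$ is upper semicontinuous for every $x\in X$ and $\pi$ is $C$-monotone, then $\pi$ is $c$-cyclically monotone. -/

import Mathlib

open MeasureTheory ProbabilityTheory

noncomputable section

/-- The integral `∫ f dp = ∫ f⁺ dp - ∫ f⁻ dp` with values in `[-∞, ∞]`.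
The value `d` is used only where this expression is `∞ - ∞`. -/
def extIntegral {Y : Type*} [MeasurableSpace Y] (d : EReal) (f : Y → ℝ) (p : Measure Y) : EReal :=
  open Classical in
  if (∫⁻ y, ENNReal.ofReal (f y) ∂p) = ⊤ ∧ (∫⁻ y, ENNReal.ofReal (-f y) ∂p) = ⊤ then d
  else ((∫⁻ y, ENNReal.ofReal (f y) ∂p : ENNReal) : EReal)
    - ((∫⁻ y, ENNReal.ofReal (-f y) ∂p : ENNReal) : EReal)

/-- The sum of finitely many extended reals.
The value `d` is used only where both `∞` and `-∞` occur among the summands. -/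
def extSum {N : ℕ} (d : EReal) (a : Fin N → EReal) : EReal :=
  open Classical in
  if (∃ i, a i = ⊤) ∧ (∃ j, a j = ⊥) then d else ∑ i, a i

/-- The weak transport cost `C(x, p) = ∫ c(x, y) p(dy)` of a cost function `c`. -/
def weakCost {X Y : Type*} [MeasurableSpace Y] (d : EReal) (c : X → Y → ℝ) (x : X)
    (p : ProbabilityMeasure Y) : EReal :=
  extIntegral d (c x) (p : Measure Y)

/-- The disintegration `x ↦ π_x` of the second coordinate given the first one. -/
def disint {X Y : Type*} [MeasurableSpace X] [MeasurableSpace Y] [StandardBorelSpace Y]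
    [Nonempty Y] (π : Measure (X × Y)) [IsFiniteMeasure π] (x : X) : ProbabilityMeasure Y :=
  ⟨π.condKernel x, inferInstance⟩

/-- `π` is `C`-monotone: there is a set `Γ` of full measure for the first marginal of `π` such that
for all `x₁, …, x_N ∈ Γ` and all probability measures `q₁, …, q_N` with `∑ π_{x_i} = ∑ q_i` we have
`∑ C(x_i, π_{x_i}) ≤ ∑ C(x_i, q_i)`. -/
def IsCMonotone {X Y : Type*} [MeasurableSpace X] [MeasurableSpace Y] [StandardBorelSpace Y]
    [Nonempty Y] (d : EReal) (C : X → ProbabilityMeasure Y → EReal)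
    (π : Measure (X × Y)) [IsFiniteMeasure π] : Prop :=
  ∃ Γ : Set X, MeasurableSet Γ ∧ π.fst Γᶜ = 0 ∧
    ∀ (N : ℕ) (x : Fin N → X) (q : Fin N → ProbabilityMeasure Y),
      (∀ i, x i ∈ Γ) →
      ∑ i, (disint π (x i) : Measure Y) = ∑ i, (q i : Measure Y) →
      extSum d (fun i => C (x i) (disint π (x i))) ≤ extSum d (fun i => C (x i) (q i))

/-- A set is `c`-cyclically monotone if `∑ c(x_i, y_i) ≤ ∑ c(x_i, y_{i+1})` for all finite
families of its points; `i + 1` in `Fin (n + 1)` is cyclic. -/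
def IsCyclicallyMonotoneSet {X Y : Type*} (c : X → Y → ℝ) (Γ : Set (X × Y)) : Prop :=
  ∀ (n : ℕ) (x : Fin (n + 1) → X) (y : Fin (n + 1) → Y),
    (∀ i, (x i, y i) ∈ Γ) → ∑ i, c (x i) (y i) ≤ ∑ i, c (x i) (y (i + 1))

/-- `π` is `c`-cyclically monotone: it is concentrated on a `c`-cyclically monotone set. -/
def IsCyclicallyMonotone {X Y : Type*} [MeasurableSpace X] [MeasurableSpace Y]
    (c : X → Y → ℝ) (π : Measure (X × Y)) : Prop :=
  ∃ Γ : Set (X × Y), MeasurableSet Γ ∧ π Γᶜ = 0 ∧ IsCyclicallyMonotoneSet c Γ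

end

/-! Part 1: Rockafellar's chain construction gives a potential `φ`. For finitely many `x i`, the
function `ψ y = min_i (c (x i) y - φ (x i))` satisfies `ψ + φ (x i) ≤ c (x i)` everywhere, with
equality almost surely under the disintegration at `x i`. The total integral of `ψ` depends only on
the sum of the measures, so no competitor `q` does better. As the minimum is finite, `φ` need not be
measurable.

Part 2: a violating cycle in a suitable support yields sets `A i` of positive mass on which the
relevant costs are within `ε` of their values at `y i`, or no worse. Passing equal mass `t` around
the cycle keeps the sum of the measures and strictly lowers the cost.

In both parts the expression `∞ - ∞` never arises, so `d` is irrelevant. -/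

open Finset in
/-- A `c`-cyclically monotone set admits a potential on its first projection. -/
theorem IsCyclicallyMonotoneSet.exists_potential {X Y : Type*} {c : X → Y → ℝ} {Γ : Set (X × Y)}
    (hΓ : IsCyclicallyMonotoneSet c Γ) :
    ∃ φ : X → ℝ, ∀ x x' y y', (x, y) ∈ Γ → (x', y') ∈ Γ → φ x' - φ x ≤ c x' y - c x y := by
  rcases Γ.eq_empty_or_nonempty with rfl | ⟨⟨x₀, y₀⟩, h₀⟩
  · exact ⟨fun _ => 0, by simp⟩
  -- `R x r`: some chain from `x` to `x₀` has cost `r`. The entry `b 0` is unconstrained; it is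
  -- overwritten when a chain is extended or closed up.
  let R : X → ℝ → Prop := fun x r => ∃ (n : ℕ) (a : Fin (n + 1) → X) (b : Fin (n + 1) → Y),
    a 0 = x ∧ a (Fin.last n) = x₀ ∧ (∀ i : Fin n, (a i.succ, b i.succ) ∈ Γ) ∧
    r = ∑ i : Fin n, (c (a i.castSucc) (b i.succ) - c (a i.succ) (b i.succ))
  have step : ∀ x r x' y, R x r → (x, y) ∈ Γ → R x' (r + (c x' y - c x y)) := by
    rintro x r x' y ⟨n, a, b, rfl, hl, hm, rfl⟩ hxy
    refine ⟨n + 1, Fin.cons x' a, Fin.cons y (Function.update b 0 y), by simp, ?_, ?_, ?_⟩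
    · rw [← Fin.succ_last, Fin.cons_succ, hl]
    · intro i
      refine Fin.cases ?_ (fun j => ?_) i
      · simpa using hxy
      · simpa using hm j
    · rw [Fin.sum_univ_succ]
      simp [add_comm]
  have start : R x₀ 0 := ⟨0, fun _ => x₀, fun _ => y₀, rfl, rfl, fun i => i.elim0, by simp⟩
  -- Closing the chain into a cycle through `y` bounds its cost below, so the infimum defining `φ`
  -- is finite over the projection of `Γ`.
  have lower : ∀ x r y, R x r → (x, y) ∈ Γ → c x y - c x₀ y ≤ r := by
    rintro x r y ⟨n, a, b, rfl, hl, hm, rfl⟩ hxy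
    have h := hΓ n a (Function.update b 0 y) (by
      intro i
      refine Fin.cases ?_ (fun j => ?_) i
      · simpa using hxy
      · simpa using hm j)
    rw [Fin.sum_univ_succ, Fin.sum_univ_castSucc (n := n)] at h
    simp only [Fin.coeSucc_eq_succ, Fin.last_add_one, Function.update_self, hl, ne_eq,
      Fin.succ_ne_zero, not_false_eq_true, Function.update_of_ne] at h
    rw [sum_sub_distrib]
    linarith
  refine ⟨fun x => sInf {r | R x r}, fun x x' y y' hx hx' => ?_⟩
  have h : sInf {r | R x' r} - (c x' y - c x y) ≤ sInf {r | R x r} := by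
    refine le_csInf ⟨_, step x₀ 0 x y₀ start h₀⟩ fun r hr => ?_
    exact sub_le_iff_le_add.2
      (csInf_le ⟨_, fun s hs => lower x' s y' hs hx'⟩ (step x r x' y hr hx))
  simp only
  linarith

/-! ### Extended integrals and sums -/

theorem extIntegral_of_integrable {Y : Type*} [MeasurableSpace Y] (d : EReal) {f : Y → ℝ}
    {p : Measure Y} (hf : Integrable f p) : extIntegral d f p = ((∫ y, f y ∂p : ℝ) : EReal) := by
  have h1 : (∫⁻ y, ENNReal.ofReal (f y) ∂p) ≠ ⊤ := hf.lintegral_lt_top.ne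
  have h2 : (∫⁻ y, ENNReal.ofReal (-f y) ∂p) ≠ ⊤ := hf.neg.lintegral_lt_top.ne
  rw [extIntegral, if_neg (fun h => h1 h.1), integral_eq_lintegral_pos_part_sub_lintegral_neg_part hf,
    EReal.coe_sub, EReal.coe_ennreal_toReal h1, EReal.coe_ennreal_toReal h2]

/-- An integrable minorant makes the negative part of `f` integrable, so a non-integrable `f` has
integral `⊤`. -/
theorem extIntegral_of_integrable_le {Y : Type*} [MeasurableSpace Y] (d : EReal) {f g : Y → ℝ}
    {p : Measure Y} (hf : AEStronglyMeasurable f p) (hg : Integrable g p) (h : ∀ y, g y ≤ f y) :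
    ((∫ y, g y ∂p : ℝ) : EReal) ≤ extIntegral d f p := by
  by_cases hfi : Integrable f p
  · rw [extIntegral_of_integrable d hfi]
    exact_mod_cast integral_mono hg hfi h
  have h2 : (∫⁻ y, ENNReal.ofReal (-f y) ∂p) < ⊤ :=
    (lintegral_mono fun y => ENNReal.ofReal_le_ofReal (neg_le_neg (h y))).trans_lt
      hg.neg.lintegral_lt_top
  have h1 : (∫⁻ y, ENNReal.ofReal (f y) ∂p) = ⊤ := by
    by_contra h1
    refine hfi ⟨hf, ?_⟩
    rw [hasFiniteIntegral_iff_norm]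
    calc ∫⁻ y, ENNReal.ofReal ‖f y‖ ∂p
        ≤ ∫⁻ y, (ENNReal.ofReal (f y) + ENNReal.ofReal (-f y)) ∂p := by
          refine lintegral_mono fun y => ?_
          rcases le_total 0 (f y) with hy | hy
          · simp [Real.norm_of_nonneg hy]
          · simp [Real.norm_of_nonpos hy]
      _ = _ := lintegral_add_left' hf.aemeasurable.ennreal_ofReal _
      _ < ⊤ := ENNReal.add_lt_top.2 ⟨lt_top_iff_ne_top.2 h1, h2⟩
  rw [extIntegral, if_neg (fun h => h2.ne h.2), h1, EReal.coe_ennreal_top,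
    ← EReal.coe_ennreal_toReal h2.ne, EReal.top_sub_coe]
  exact le_top

theorem EReal.coe_finset_sum {ι : Type*} (s : Finset ι) (f : ι → ℝ) :
    ((∑ i ∈ s, f i : ℝ) : EReal) = ∑ i ∈ s, (f i : EReal) := by
  classical
  induction s using Finset.induction_on with
  | empty => simp
  | insert i s hi ih => rw [Finset.sum_insert hi, Finset.sum_insert hi, EReal.coe_add, ih]

theorem coe_sum_le_extSum {N : ℕ} (d : EReal) {a : Fin N → EReal} {b : Fin N → ℝ}
    (h : ∀ i, (b i : EReal) ≤ a i) : ((∑ i, b i : ℝ) : EReal) ≤ extSum d a := by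
  rw [extSum, if_neg, EReal.coe_finset_sum]
  · exact Finset.sum_le_sum fun i _ => h i
  · rintro ⟨-, j, hj⟩
    exact EReal.coe_ne_bot _ (le_bot_iff.1 (hj ▸ h j))

theorem extSum_coe {N : ℕ} (d : EReal) (b : Fin N → ℝ) :
    extSum d (fun i => (b i : EReal)) = ((∑ i, b i : ℝ) : EReal) := by
  rw [extSum, if_neg, EReal.coe_finset_sum]
  rintro ⟨-, j, hj⟩
  exact EReal.coe_ne_bot _ hj

/-- An almost sure property holds on a measurable set of full measure. -/
theorem exists_measurableSet_of_ae {X : Type*} [MeasurableSpace X] {μ : Measure X} {P : X → Prop}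
    (h : ∀ᵐ x ∂μ, P x) : ∃ s, MeasurableSet s ∧ μ sᶜ = 0 ∧ ∀ x ∈ s, P x :=
  ⟨(toMeasurable μ {x | ¬ P x})ᶜ, (measurableSet_toMeasurable _ _).compl,
    by rw [compl_compl, measure_toMeasurable]; exact h,
    fun _ hx => not_not.1 fun hP => hx (subset_toMeasurable _ _ hP)⟩

/-! ### Cyclic monotonicity implies `C`-monotonicity -/

theorem IsCyclicallyMonotone.isCMonotone {X Y : Type*} [MeasurableSpace X] [MeasurableSpace Y]
    [StandardBorelSpace Y] [Nonempty Y] {π : Measure (X × Y)} [IsProbabilityMeasure π]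
    {c : X → Y → ℝ} (hc : Measurable (Function.uncurry c))
    (hci : Integrable (Function.uncurry c) π) (d : EReal) (h : IsCyclicallyMonotone c π) :
    IsCMonotone d (weakCost d c) π := by
  obtain ⟨Γ, hΓm, hΓ, hmon⟩ := h
  obtain ⟨φ, hφ⟩ := hmon.exists_potential
  have hcx : ∀ x, Measurable (c x) := fun x => hc.comp measurable_prodMk_left
  have h1 : ∀ᵐ x ∂π.fst, ∀ᵐ y ∂π.condKernel x, (x, y) ∈ Γ := by
    have : ∀ᵐ z ∂(π.fst ⊗ₘ π.condKernel), z ∈ Γ := by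
      rw [π.disintegrate π.condKernel]; exact hΓ
    exact Measure.ae_ae_of_ae_compProd this
  obtain ⟨S, hSm, hS, hSP⟩ := exists_measurableSet_of_ae (h1.and hci.condKernel_ae)
  refine ⟨S, hSm, hS, fun N x q hx hsum => ?_⟩
  let ψ : Y → ℝ := fun y => ⨅ i, (c (x i) y - φ (x i))
  have hψm : Measurable ψ := Measurable.iInf fun i => (hcx _).sub_const _
  have hψle : ∀ i y, ψ y + φ (x i) ≤ c (x i) y := fun i y => by
    have := ciInf_le (Set.finite_range fun i => c (x i) y - φ (x i)).bddBelow i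
    simp only [ψ]
    linarith
  -- The inequality for `φ` needs both points in the projection of `Γ`.
  have hne : ∀ i, ∃ y, (x i, y) ∈ Γ := fun i => (hSP _ (hx i)).1.exists
  have hψeq : ∀ i, c (x i) =ᵐ[π.condKernel (x i)] fun y => ψ y + φ (x i) := fun i => by
    filter_upwards [(hSP _ (hx i)).1] with y hy
    refine le_antisymm ?_ (hψle i y)
    have : Nonempty (Fin N) := ⟨i⟩
    have : c (x i) y - φ (x i) ≤ ψ y := le_ciInf fun j => by
      obtain ⟨y', hy'⟩ := hne j
      linarith [hφ _ _ _ _ hy hy']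
    linarith
  have hci' : ∀ i, Integrable (c (x i)) (π.condKernel (x i)) := fun i => (hSP _ (hx i)).2
  have hψi : ∀ i, Integrable ψ (π.condKernel (x i)) := fun i => by
    refine (((hci' i).congr (hψeq i)).sub (integrable_const (φ (x i)))).congr ?_
    exact Filter.Eventually.of_forall fun y => by simp
  -- Integrability passes to each `q i` through the common sum of the measures.
  have hψS : Integrable ψ (∑ i, (q i : Measure Y)) := by
    rw [← hsum]
    exact integrable_finsetSum_measure.2 fun i _ => hψi i
  have hψq : ∀ i, Integrable ψ (q i : Measure Y) := fun i =>
    (integrable_finsetSum_measure.1 hψS) i (Finset.mem_univ i)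
  have hint : ∑ i, ∫ y, ψ y ∂(π.condKernel (x i)) = ∑ i, ∫ y, ψ y ∂(q i : Measure Y) := by
    rw [← integral_finsetSum_measure fun i _ => hψi i,
      ← integral_finsetSum_measure fun i _ => hψq i, ← hsum]
    rfl
  have hL : ∀ i, weakCost d c (x i) (disint π (x i))
      = ((∫ y, ψ y ∂(π.condKernel (x i)) + φ (x i) : ℝ) : EReal) := fun i => by
    rw [weakCost, disint, ProbabilityMeasure.coe_mk, extIntegral_of_integrable d (hci' i),
      integral_congr_ae (hψeq i), integral_add (hψi i) (integrable_const _)]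
    simp
  simp_rw [hL]
  rw [extSum_coe, Finset.sum_add_distrib, hint, ← Finset.sum_add_distrib]
  refine coe_sum_le_extSum d fun i => ?_
  have := extIntegral_of_integrable_le d (hcx (x i)).aestronglyMeasurable
    ((hψq i).add (integrable_const (φ (x i)))) (hψle i)
  rw [weakCost]
  convert this
  rw [integral_add' (hψq i) (integrable_const _)]
  simp

/-! ### Cyclic exchange of mass and the converse -/

/-- Moving the fraction `s i` of the mass of `p i` on `A i` to the measure with index `i - 1`. -/
theorem exists_cyclic_exchange {Y : Type*} [MeasurableSpace Y] {n : ℕ}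
    (p : Fin (n + 1) → ProbabilityMeasure Y) {A : Fin (n + 1) → Set Y}
    (hA : ∀ i, MeasurableSet (A i)) (hpos : ∀ i, (p i : Measure Y) (A i) ≠ 0) :
    ∃ (t : ℝ) (s : Fin (n + 1) → ℝ) (q : Fin (n + 1) → ProbabilityMeasure Y), 0 < t ∧
      (∀ i, 0 ≤ s i ∧ s i * (p i : Measure Y).real (A i) = t) ∧
      ∑ i, (p i : Measure Y) = ∑ i, (q i : Measure Y) ∧
      ∀ (i) (f : Y → ℝ), Integrable f (p i : Measure Y) →
        IntegrableOn f (A (i + 1)) (p (i + 1) : Measure Y) →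
        Integrable f (q i : Measure Y) ∧ ∫ y, f y ∂(q i : Measure Y) =
          ∫ y, f y ∂(p i : Measure Y) - s i * ∫ y in A i, f y ∂(p i : Measure Y)
          + s (i + 1) * ∫ y in A (i + 1), f y ∂(p (i + 1) : Measure Y) := by
  let m : Fin (n + 1) → NNReal := fun i => p i (A i)
  -- With the product of the other masses as fraction, every index moves the same mass `∏ j, m j`,
  -- without division.
  let s : Fin (n + 1) → NNReal := fun i => ∏ j ∈ Finset.univ.erase i, m j
  have hm : ∀ i, (m i : ENNReal) = (p i : Measure Y) (A i) := fun i => by simp [m]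
  have hm1 : ∀ i, m i ≤ 1 := fun i => (p i).apply_le_one _
  have hs1 : ∀ i, s i ≤ 1 := fun i => Finset.prod_le_one' fun j _ => hm1 j
  have hst : ∀ i, s i * m i = ∏ j, m j := fun i =>
    Finset.prod_erase_mul _ _ (Finset.mem_univ i)
  have hmass : ∀ i, (s i • (p i : Measure Y).restrict (A i)) Set.univ
      = ((∏ j, m j : NNReal) : ENNReal) := fun i => by
    rw [← hst i, ENNReal.coe_mul, hm, Measure.smul_apply, Measure.restrict_apply_univ,
      ENNReal.smul_def, smul_eq_mul]
  have hsplit : ∀ i, (1 - s i) • (p i : Measure Y).restrict (A i)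
      + s i • (p i : Measure Y).restrict (A i) = (p i : Measure Y).restrict (A i) := fun i => by
    rw [← add_smul, tsub_add_cancel_of_le (hs1 i), one_smul]
  let r : Fin (n + 1) → Measure Y := fun i =>
    (p i : Measure Y).restrict (A i)ᶜ + (1 - s i) • (p i : Measure Y).restrict (A i)
  have hr : ∀ i, r i + s i • (p i : Measure Y).restrict (A i) = p i := fun i => by
    simp only [r]
    rw [add_assoc, hsplit, add_comm, Measure.restrict_add_restrict_compl (hA i)]
  let q : Fin (n + 1) → Measure Y := fun i =>
    r i + s (i + 1) • (p (i + 1) : Measure Y).restrict (A (i + 1))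
  have hq : ∀ i, IsProbabilityMeasure (q i) := fun i => ⟨by
    have h : r i Set.univ + (s i • (p i : Measure Y).restrict (A i)) Set.univ = 1 := by
      rw [← Measure.add_apply, hr, measure_univ]
    rw [hmass] at h
    rw [Measure.add_apply, hmass, h]⟩
  refine ⟨(∏ j, m j : NNReal), fun i => s i, fun i => ⟨q i, hq i⟩, ?_, fun i => ⟨(s i).2, ?_⟩, ?_,
    fun i f hf hf' => ?_⟩
  · rw [NNReal.coe_pos]
    refine Finset.prod_pos fun i _ => pos_iff_ne_zero.2 fun h => hpos i ?_
    rw [← hm, h, ENNReal.coe_zero]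
  · rw [← hst i]
    rfl
  · simp only [ProbabilityMeasure.coe_mk, q]
    have hshift : ∑ i, s (i + 1) • (p (i + 1) : Measure Y).restrict (A (i + 1))
        = ∑ i, s i • (p i : Measure Y).restrict (A i) :=
      (Equiv.addRight (1 : Fin (n + 1))).bijective.sum_comp
        (fun i => s i • (p i : Measure Y).restrict (A i))
    rw [Finset.sum_add_distrib, hshift, ← Finset.sum_add_distrib]
    exact Finset.sum_congr rfl fun i _ => (hr i).symm
  · have hri : Integrable f (r i) := hf.mono_measure ((hr i) ▸ Measure.le_add_right le_rfl)
    have hsi : ∀ i, IntegrableOn f (A i) (p i : Measure Y) →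
        Integrable f (s i • (p i : Measure Y).restrict (A i)) := fun i h =>
      h.smul_measure_nnreal
    have h1 : ∫ y, f y ∂(p i : Measure Y)
        = ∫ y, f y ∂(r i) + s i * ∫ y in A i, f y ∂(p i : Measure Y) := by
      conv_lhs => rw [← hr i]
      rw [integral_add_measure hri (hsi i hf.integrableOn), integral_smul_nnreal_measure]
      rfl
    refine ⟨hri.add_measure (hsi _ hf'), ?_⟩
    rw [ProbabilityMeasure.coe_mk, integral_add_measure hri (hsi _ hf'),
      integral_smul_nnreal_measure, h1, NNReal.smul_def, smul_eq_mul]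
    ring

/-- Almost every point lies in the support of the image measure under the graph of `f`;
this is measurable in the parameter. -/
theorem exists_measurableSet_graph_support {X Y : Type*} [MeasurableSpace X] [TopologicalSpace Y]
    [SecondCountableTopology Y] [MeasurableSpace Y] [OpensMeasurableSpace Y]
    (κ : Kernel X Y) [IsSFiniteKernel κ] {c : X → Y → ℝ} (hc : Measurable (Function.uncurry c)) :
    ∃ S : Set (X × Y), MeasurableSet S ∧ (∀ x, ∀ᵐ y ∂κ x, (x, y) ∈ S) ∧
      ∀ x y, (x, y) ∈ S → ∀ U : Set (Y × ℝ), IsOpen U → (y, c x y) ∈ U →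
        κ x {y' | (y', c x y') ∈ U} ≠ 0 := by
  -- Only countably many null preimages need be discarded.
  let B := TopologicalSpace.countableBasis (Y × ℝ)
  have hB := TopologicalSpace.isBasis_countableBasis (Y × ℝ)
  have hBc : B.Countable := TopologicalSpace.countable_countableBasis _
  have hg : Measurable fun z : X × Y => (z.2, c z.1 z.2) := measurable_snd.prodMk hc
  refine ⟨⋂ U ∈ B, {z : X × Y | (z.2, c z.1 z.2) ∈ U → κ z.1 {y' | (y', c z.1 y') ∈ U} ≠ 0},
    ?_, ?_, ?_⟩
  · refine MeasurableSet.biInter hBc fun U hU => ?_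
    have hUm : MeasurableSet U := (hB.isOpen hU).measurableSet
    have h1 : Measurable fun x => κ x {y' | (y', c x y') ∈ U} :=
      Kernel.measurable_kernel_prodMk_left (hg hUm)
    have h2 : MeasurableSet {z : X × Y | κ z.1 {y' | (y', c z.1 y') ∈ U} = 0} :=
      (h1.comp measurable_fst) (measurableSet_singleton 0)
    exact (hg hUm).imp h2.compl
  · intro x
    simp only [Set.mem_iInter]
    refine (ae_ball_iff hBc).2 fun U hU => ?_
    by_cases h : κ x {y' | (y', c x y') ∈ U} = 0
    · filter_upwards [compl_mem_ae_iff.2 h] with y hy hy'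
      exact absurd hy' hy
    · exact Filter.Eventually.of_forall fun y _ => h
  · intro x y hxy U hU hyU
    obtain ⟨V, hV, hyV, hVU⟩ := hB.exists_subset_of_mem_open hyU hU
    simp only [Set.mem_iInter] at hxy
    exact fun h => hxy V hV hyV (measure_mono_null (fun y' hy' => hVU hy') h)

theorem IsCMonotone.isCyclicallyMonotone {X Y : Type*} [MeasurableSpace X] [TopologicalSpace Y]
    [SecondCountableTopology Y] [MeasurableSpace Y] [BorelSpace Y]
    [StandardBorelSpace Y] [Nonempty Y] {π : Measure (X × Y)} [IsProbabilityMeasure π]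
    {c : X → Y → ℝ} (hc : Measurable (Function.uncurry c))
    (hci : Integrable (Function.uncurry c) π) (husc : ∀ x, UpperSemicontinuous (c x)) {d : EReal}
    (h : IsCMonotone d (weakCost d c) π) : IsCyclicallyMonotone c π := by
  obtain ⟨Γ, hΓm, hΓ, hmon⟩ := h
  have hcx : ∀ x, Measurable (c x) := fun x => hc.comp measurable_prodMk_left
  obtain ⟨Γ', hΓm', hΓ', hint⟩ := exists_measurableSet_of_ae hci.condKernel_ae
  obtain ⟨S, hSm, hS, hSU⟩ := exists_measurableSet_graph_support π.condKernel hc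
  refine ⟨Prod.fst ⁻¹' (Γ ∩ Γ') ∩ S, (measurable_fst (hΓm.inter hΓm')).inter hSm, ?_, ?_⟩
  · have hm := (measurable_fst (hΓm.inter hΓm')).inter hSm
    have : ∀ᵐ z ∂(π.fst ⊗ₘ π.condKernel), z ∈ Prod.fst ⁻¹' (Γ ∩ Γ') ∩ S := by
      refine (Measure.ae_compProd_iff hm).2 ?_
      filter_upwards [mem_ae_iff.2 hΓ, mem_ae_iff.2 hΓ'] with x hx hx'
      filter_upwards [hS x] with y hy
      exact ⟨⟨hx, hx'⟩, hy⟩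
    rwa [π.disintegrate π.condKernel] at this
  intro n x y hxy
  by_contra! hlt
  have hxΓ : ∀ i, x i ∈ Γ := fun i => (hxy i).1.1
  have hxi : ∀ i, Integrable (c (x i)) (π.condKernel (x i)) := fun i => hint _ (hxy i).1.2
  obtain ⟨ε, hε, hεlt⟩ : ∃ ε : ℝ, 0 < ε ∧
      ∑ i, c (x i) (y (i + 1)) + (n + 1) * (2 * ε) < ∑ i, c (x i) (y i) := by
    refine ⟨(∑ i, c (x i) (y i) - ∑ i, c (x i) (y (i + 1))) / (4 * (n + 1)), by
      have := sub_pos.2 hlt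
      positivity, ?_⟩
    field_simp
    linarith
  -- The lower bound on `c (x (i + 1))` comes from the graph support, the upper bound on `c (x i)`
  -- from semicontinuity. Truncation by `M` is needed since `c (x i)` may fail to be integrable
  -- under the disintegration at `x (i + 1)`.
  have hAex : ∀ i : Fin (n + 1), ∃ A : Set Y, MeasurableSet A ∧ π.condKernel (x (i + 1)) A ≠ 0 ∧
      (∀ z ∈ A, c (x (i + 1)) (y (i + 1)) - ε ≤ c (x (i + 1)) z) ∧
      (∀ z ∈ A, c (x i) z ≤ c (x i) (y (i + 1)) + ε) ∧
      ∃ M : ℝ, ∀ z ∈ A, M ≤ c (x i) z := by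
    intro i
    let V : Set Y := {z | c (x i) z < c (x i) (y (i + 1)) + ε}
    have hV : IsOpen V := (husc (x i)).isOpen_preimage _
    let A : Set Y := {z | (z, c (x (i + 1)) z) ∈ V ×ˢ Set.Ioi (c (x (i + 1)) (y (i + 1)) - ε)}
    have hA : π.condKernel (x (i + 1)) A ≠ 0 :=
      hSU _ _ (hxy (i + 1)).2 _ (hV.prod isOpen_Ioi) ⟨by simpa [V] using hε, by simpa using hε⟩
    have hAm : MeasurableSet A := hV.measurableSet.inter (hcx _ measurableSet_Ioi)
    have hAU : A = ⋃ k : ℕ, A ∩ {z | -(k : ℝ) ≤ c (x i) z} := by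
      rw [← Set.inter_iUnion, eq_comm, Set.inter_eq_left]
      intro z _
      obtain ⟨k, hk⟩ := exists_nat_ge (-c (x i) z)
      exact Set.mem_iUnion.2 ⟨k, by simp only [Set.mem_ofPred_eq]; linarith⟩
    obtain ⟨k, hk⟩ : ∃ k : ℕ, π.condKernel (x (i + 1)) (A ∩ {z | -(k : ℝ) ≤ c (x i) z}) ≠ 0 := by
      by_contra! h0
      exact hA (by rw [hAU]; exact measure_iUnion_null h0)
    exact ⟨_, hAm.inter (hcx _ measurableSet_Ici), hk, fun z hz => le_of_lt hz.1.2,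
      fun z hz => le_of_lt hz.1.1, -(k : ℝ), fun z hz => hz.2⟩
  choose A' hA'm hA'pos hA'low hA'up M hM using hAex
  let A : Fin (n + 1) → Set Y := fun i => A' (i - 1)
  have hAA : ∀ i, A (i + 1) = A' i := fun i => by simp [A]
  have hAm : ∀ i, MeasurableSet (A i) := fun i => hA'm _
  have hApos : ∀ i, (disint π (x i) : Measure Y) (A i) ≠ 0 := fun i => by
    have := hA'pos (i - 1)
    rwa [sub_add_cancel] at this
  have hAlow : ∀ i, ∀ z ∈ A i, c (x i) (y i) - ε ≤ c (x i) z := fun i z hz => by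
    have := hA'low (i - 1) z hz
    rwa [sub_add_cancel] at this
  obtain ⟨t, s, q, ht, hs, hsum, hq⟩ := exists_cyclic_exchange (fun i => disint π (x i)) hAm hApos
  have hon : ∀ i, IntegrableOn (c (x i)) (A (i + 1)) (disint π (x (i + 1)) : Measure Y) := by
    intro i
    rw [hAA]
    refine Measure.integrableOn_of_bounded
      (M := max |M i| |c (x i) (y (i + 1)) + ε|) (measure_ne_top _ _)
      (hcx _).aestronglyMeasurable ?_
    filter_upwards [ae_restrict_mem (hA'm i)] with z hz
    exact abs_le_max_abs_abs (hM i z hz) (hA'up i z hz)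
  have hqi := fun i => hq i (c (x i)) (hxi i) (hon i)
  have hle := hmon (n + 1) x q hxΓ hsum
  have e1 : ∀ i, weakCost d c (x i) (disint π (x i))
      = ((∫ z, c (x i) z ∂(disint π (x i) : Measure Y) : ℝ) : EReal) := fun i =>
    extIntegral_of_integrable d (hxi i)
  have e2 : ∀ i, weakCost d c (x i) (q i) = ((∫ z, c (x i) z ∂(q i : Measure Y) : ℝ) : EReal) :=
    fun i => extIntegral_of_integrable d (hqi i).1
  simp_rw [e1, e2, extSum_coe, EReal.coe_le_coe_iff] at hle
  refine absurd hle (not_le.2 ?_)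
  have b1 : ∀ i, t * (c (x i) (y i) - ε)
      ≤ s i * ∫ z in A i, c (x i) z ∂(disint π (x i) : Measure Y) := fun i => by
    rw [← (hs i).2, mul_assoc]
    refine mul_le_mul_of_nonneg_left ?_ (hs i).1
    have := setIntegral_mono_on (integrable_const (c (x i) (y i) - ε)).integrableOn
      (hxi i).integrableOn (hAm i) (hAlow i)
    rw [setIntegral_const, smul_eq_mul] at this
    exact this
  have b2 : ∀ i, s (i + 1) * ∫ z in A (i + 1), c (x i) z ∂(disint π (x (i + 1)) : Measure Y)
      ≤ t * (c (x i) (y (i + 1)) + ε) := fun i => by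
    rw [← (hs (i + 1)).2, mul_assoc]
    refine mul_le_mul_of_nonneg_left ?_ (hs (i + 1)).1
    have := setIntegral_mono_on (hon i) (integrable_const (c (x i) (y (i + 1)) + ε)).integrableOn
      (hAm (i + 1)) (by rw [hAA]; exact hA'up i)
    rw [setIntegral_const, smul_eq_mul] at this
    exact this
  -- Each index loses one `ε` on the mass removed and one on the mass received.
  calc ∑ i, ∫ z, c (x i) z ∂(q i : Measure Y)
      ≤ ∑ i, (∫ z, c (x i) z ∂(disint π (x i) : Measure Y)
          + t * (c (x i) (y (i + 1)) + 2 * ε - c (x i) (y i))) := by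
        refine Finset.sum_le_sum fun i _ => ?_
        rw [(hqi i).2]
        linarith [b1 i, b2 i]
    _ = ∑ i, ∫ z, c (x i) z ∂(disint π (x i) : Measure Y)
          + t * (∑ i, c (x i) (y (i + 1)) + (n + 1) * (2 * ε) - ∑ i, c (x i) (y i)) := by
        rw [Finset.sum_add_distrib, ← Finset.mul_sum, Finset.sum_sub_distrib,
          Finset.sum_add_distrib]
        simp
    _ < _ := add_lt_of_neg_right _ (mul_neg_of_pos_of_neg ht (by linarith))

theorem theorem4p1 {X Y : Type*}
    [TopologicalSpace X] [PolishSpace X] [MeasurableSpace X] [BorelSpace X]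
    [TopologicalSpace Y] [PolishSpace Y] [MeasurableSpace Y] [BorelSpace Y] [Nonempty Y]
    (π : Measure (X × Y)) [IsProbabilityMeasure π]
    (c : X → Y → ℝ) (hc : Measurable (Function.uncurry c))
    (hci : Integrable (Function.uncurry c) π) (d : EReal) :
    (IsCyclicallyMonotone c π → IsCMonotone d (weakCost d c) π) ∧
    ((∀ x, UpperSemicontinuous (c x)) →
      IsCMonotone d (weakCost d c) π → IsCyclicallyMonotone c π) := by
  exact ⟨fun h => h.isCMonotone hc hci d, fun husc h => h.isCyclicallyMonotone hc hci husc⟩
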